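/- Let $M,N\ge 1$ and $1\le\nu\le N-1$ be integers, $H\in\mathbb{C}^{M\times N}$, $E_s,N_0>0$. Let $y=Hx+n$ with independent $x\sim\mathcal{CN}(0,E_sI_N)$ and $n\sim\mathcal{CN}(0,N_0I_M)$; write $p(x)=(\pi E_s)^{-N}e^{-\|x\|^2/E_s}$. For $F\in\mathbb{C}^{M\times N}$ and a positive semidefinite $G\in\mathbb{C}^{N\times N}$ consider the mismatched model $$p_{\mathrm m}(y|x)=\exp\bigl(2\,\mathrm{Re}(y^\dagger Fx)-x^\dagger Gx+\tfrac1{E_s}x^\dagger x\bigr),\qquad p_{\mathrm m}(y)=\int_{\mathbb{C}^N}p_{\mathrm m}(y|x)\,p(x)\,dx\in(0,\infty],$$ and the lower bound on the achievable information rate $$I_{\mathrm{LB}}(F,G)=\mathbb{E}_{Y,X}[\ln p_{\mathrm m}(y|x)]-\mathbb{E}_{Y}[\ln p_{\mathrm m}(y)]\in[-\infty,\infty),$$ the expectations being over the true law of $(x,y)$. Call a lower-triangular $J=[J_{kj}]\in\mathbb{C}^{N\times N}$ punctured of order $\nu$ if $J_{kj}=0$ for $\nu<j<k\le N$ and $J_{kk}$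 is real for $k>\nu$, and call $G$ admissible if $G$ is positive semidefinite and $G=J^\dagger J$ for some $J$ punctured of order $\nu$. Let $W_{\mathrm{mmse}}=H^\dagger\bigl(HH^\dagger+\tfrac{N_0}{E_s}I_M\bigr)^{-1}$, and let $H_a=\begin{bmatrix}\frac1{\sqrt{N_0}}H\\ \frac1{\sqrt{E_s}}I_N\end{bmatrix}=Q_aL_a$ be the thin QL decomposition ($Q_a^\dagger Q_a=I_N$, $L_a$ lower triangular with positive diagonal). Partition $L_a=\begin{bmatrix}P_a&0\\R_a&S_a\end{bmatrix}$ with $P_a$ of size $\nu\times\nu$, put $\Omega_a=\mathrm{diag}(S_a^{-1}S_a^{-\dagger})^{-1/2}$ and $$L_{ap}=\begin{bmatrix}I_\nu&0\\0&\Omega_aS_a^{-1}\end{bmatrix}L_a=\begin{bmatrix}P_a&0\\ \Omega_aS_a^{-1}R_a&\Omega_a\end{bmatrix}.$$ Then $L_{ap}$ is punctured of order $\nu$, $G^{\mathrm{opt}}=L_{ap}^\dagger L_{ap}$ is admissible and positive definite, and with $F^{\mathrm{opt}}=W_{\mathrm{mmse}}^\dagger G^{\mathrm{opt}}$ the pair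 $(F^{\mathrm{opt}},G^{\mathrm{opt}})$ is the unique maximizer of $I_{\mathrm{LB}}(F,G)$ over all $F\in\mathbb{C}^{M\times N}$ and all admissible $G$. The maximal value is $$I_{\mathrm{LB}}(F^{\mathrm{opt}},G^{\mathrm{opt}})=N\ln E_s+\ln\det(L_{ap}^\dagger L_{ap}).$$ -/

import Mathlib

open MeasureTheory Matrix
open scoped ENNReal ComplexOrder

noncomputable section

/-- The circularly symmetric complex Gaussian law `CN(0, v I)` on `ℂⁿ`, through its density
`(π v)⁻ⁿ exp (-‖x‖² / v)` with respect to Lebesgue measure. -/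
def complexGaussian (n : ℕ) (v : ℝ) : Measure (Fin n → ℂ) :=
  volume.withDensity fun x =>
    ENNReal.ofReal (1 / (Real.pi * v) ^ n * Real.exp (-(∑ i, ‖x i‖ ^ 2) / v))

/-- The joint law of `(x, y)`, where `y = H x + n`, with independent `x ∼ CN(0, Es I)` and
`n ∼ CN(0, N0 I)`. -/
def channelLaw {M N : ℕ} (H : Matrix (Fin M) (Fin N) ℂ) (Es N0 : ℝ) :
    Measure ((Fin N → ℂ) × (Fin M → ℂ)) :=
  ((complexGaussian N Es).prod (complexGaussian M N0)).map fun p => (p.1, H *ᵥ p.1 + p.2)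

/-- Expectation of an extended-real random variable, `E[f⁺] - E[f⁻]`, with values in `[-∞, ∞]`. -/
def extendedExpectation {Ω : Type*} [MeasurableSpace Ω] (P : Measure Ω) (f : Ω → EReal) : EReal :=
  ((∫⁻ ω, (f ω).toENNReal ∂P : ℝ≥0∞) : EReal) - ((∫⁻ ω, (-f ω).toENNReal ∂P : ℝ≥0∞) : EReal)

/-- The modified mismatched metric `2 Re(y† F x) - x† G x + x† x / Es`. -/
def modifiedMetric {M N : ℕ} (Es : ℝ) (F : Matrix (Fin M) (Fin N) ℂ)
    (G : Matrix (Fin N) (Fin N) ℂ) (y : Fin M → ℂ) (x : Fin N → ℂ) : ℝ :=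
  2 * (star y ⬝ᵥ (F *ᵥ x)).re - (star x ⬝ᵥ (G *ᵥ x)).re + 1 / Es * (star x ⬝ᵥ x).re

/-- The mismatched conditional "density" `exp (μ(y|x))`. -/
def mismatchedCond {M N : ℕ} (Es : ℝ) (F : Matrix (Fin M) (Fin N) ℂ)
    (G : Matrix (Fin N) (Fin N) ℂ) (y : Fin M → ℂ) (x : Fin N → ℂ) : ℝ≥0∞ :=
  ENNReal.ofReal (Real.exp (modifiedMetric Es F G y x))

/-- The mismatched output "density" `∫ exp (μ(y|x)) p(x) dx`, with values in `[0, ∞]`, for the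
Gaussian prior `x ∼ CN(0, Es I)`. -/
def mismatchedOutput {M N : ℕ} (Es : ℝ) (F : Matrix (Fin M) (Fin N) ℂ)
    (G : Matrix (Fin N) (Fin N) ℂ) (y : Fin M → ℂ) : ℝ≥0∞ :=
  ∫⁻ x, mismatchedCond Es F G y x ∂(complexGaussian N Es)

/-- The lower bound on the achievable information rate,
`E_{Y,X}[ln p(y|x)] - E_Y[ln p(y)]` for the mismatched model; the expectations are over the true
channel statistics. It is `-∞` when `p(y) = ∞` (singular positive semidefinite `G`). -/
def rateLowerBound {M N : ℕ} (H : Matrix (Fin M) (Fin N) ℂ) (Es N0 : ℝ)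
    (F : Matrix (Fin M) (Fin N) ℂ) (G : Matrix (Fin N) (Fin N) ℂ) : EReal :=
  extendedExpectation (channelLaw H Es N0)
      (fun p => ENNReal.log (mismatchedCond Es F G p.2 p.1)) -
    extendedExpectation (channelLaw H Es N0)
      (fun p => ENNReal.log (mismatchedOutput Es F G p.2))

/-- The MMSE filter `H† (H H† + α I)⁻¹`, `α = N0 / Es`. -/
def mmseFilter {M N : ℕ} (H : Matrix (Fin M) (Fin N) ℂ) (Es N0 : ℝ) :
    Matrix (Fin N) (Fin M) ℂ :=
  Hᴴ * (H * Hᴴ + ((N0 / Es : ℝ) : ℂ) • (1 : Matrix (Fin M) (Fin M) ℂ))⁻¹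

/-- The augmented channel, `H / √N0` stacked on top of `I / √Es`. -/
def augmentedChannel {M N : ℕ} (H : Matrix (Fin M) (Fin N) ℂ) (Es N0 : ℝ) :
    Matrix (Fin M ⊕ Fin N) (Fin N) ℂ :=
  Matrix.fromRows (((1 / Real.sqrt N0 : ℝ) : ℂ) • H)
    (((1 / Real.sqrt Es : ℝ) : ℂ) • (1 : Matrix (Fin N) (Fin N) ℂ))

/-- `A = Q L` is a thin QL decomposition: `Q` has orthonormal columns and `L` is lower triangular
with real positive diagonal. -/
structure IsThinQL {m : Type*} [Fintype m] {N : ℕ} (A Q : Matrix m (Fin N) ℂ)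
    (L : Matrix (Fin N) (Fin N) ℂ) : Prop where
  eq_mul : A = Q * L
  orthonormal : Qᴴ * Q = 1
  lower : ∀ i j, i < j → L i j = 0
  diag_im : ∀ i, (L i i).im = 0
  diag_pos : ∀ i, 0 < (L i i).re

/-- Lower-triangular matrices punctured to order `ν`: the block of the last `N - ν` rows and
columns is real diagonal, the first `ν` columns are not restricted further. -/
structure IsPunctured {N : ℕ} (ν : ℕ) (J : Matrix (Fin N) (Fin N) ℂ) : Prop where
  lower : ∀ k j, k < j → J k j = 0
  punctured : ∀ k j : Fin N, ν ≤ (j : ℕ) → j < k → J k j = 0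
  diag_im : ∀ k : Fin N, ν ≤ (k : ℕ) → (J k k).im = 0

/-- The block of `L` of the last `N - ν` rows and columns. -/
def childBlock {N : ℕ} (ν : ℕ) (L : Matrix (Fin N) (Fin N) ℂ) :
    Matrix {i : Fin N // ¬ (i : ℕ) < ν} {i : Fin N // ¬ (i : ℕ) < ν} ℂ :=
  L.toBlock (fun i => ¬ (i : ℕ) < ν) (fun i => ¬ (i : ℕ) < ν)

/-- `Ω = diag(S⁻¹ S⁻†)^(-1/2)`. -/
def puncturingScale {m : Type*} [Fintype m] [DecidableEq m] (S : Matrix m m ℂ) : Matrix m m ℂ :=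
  Matrix.diagonal fun i => ((1 / Real.sqrt ((S⁻¹ * (S⁻¹)ᴴ) i i).re : ℝ) : ℂ)

/-- The left puncturing matrix with blocks `[I, 0; 0, Ω S⁻¹]`, where `S` is the block of the last
`N - ν` rows and columns of `L`. -/
def puncturingMatrix {N : ℕ} (ν : ℕ) (L : Matrix (Fin N) (Fin N) ℂ) :
    Matrix (Fin N) (Fin N) ℂ :=
  Matrix.reindex (Equiv.sumCompl fun i : Fin N => (i : ℕ) < ν)
    (Equiv.sumCompl fun i : Fin N => (i : ℕ) < ν)
    (Matrix.fromBlocks 1 0 0 (puncturingScale (childBlock ν L) * (childBlock ν L)⁻¹))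

/-- The punctured matrix. -/
def puncture {N : ℕ} (ν : ℕ) (L : Matrix (Fin N) (Fin N) ℂ) : Matrix (Fin N) (Fin N) ℂ :=
  puncturingMatrix ν L * L

/-- The admissible `G`: positive semidefinite with a punctured factor of order `ν`. -/
def IsAdmissible {N : ℕ} (ν : ℕ) (G : Matrix (Fin N) (Fin N) ℂ) : Prop :=
  G.PosSemidef ∧ ∃ J : Matrix (Fin N) (Fin N) ℂ, IsPunctured ν J ∧ G = Jᴴ * J

end

/-! For singular admissible `G` the mismatched output is infinite for every `y`, so the rate is `⊥`.
For positive definite `G` all expectations are Gaussian second moments. Completing the square in `F`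
gives N + N log Es + (log det G - tr(G (L†L)⁻¹)) - Es tr(D G⁻¹ D† A), where D = F - W†G, W is the
MMSE filter, A = HH† + (N0/Es) I, and (L†L)⁻¹ is the MMSE error covariance (`rateLowerBound_eq`).
The last trace is a squared Frobenius norm that vanishes only at D = 0 (`trace_sandwich_nonneg`),
which fixes `F` in terms of `G`.

It remains to maximize over G = J†J, where tr(G (L†L)⁻¹) = ‖J L⁻¹‖². Let P be the puncturing matrix,
so that PL is the punctured factor, and let C be the diagonal matrix of the ratios c_k = J_kk /
(PL)_kk. Then J L⁻¹ = C P + E, where E is supported on entries at which P vanishes. Since the rows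
of P are unit vectors, ‖J L⁻¹‖² = Σ|c_k|² + ‖E‖², while log det G exceeds its value at the claimed
optimum by Σ log|c_k|². The inequality log t ≤ t - 1 finishes (`log_det_sub_trace_le`). Equality
forces E = 0 and |c_k| = 1, so J is the punctured factor up to row phases, which disappear in J†J.
-/

/-! ### Lower-triangular matrices: determinants, inverses, positive diagonal. -/

theorem trace_mul_conjTranspose_eq_sum_normSq {m n : Type*} [Fintype m] [Fintype n]
    (T : Matrix m n ℂ) :
    (T * Tᴴ).trace = ((∑ k, ∑ j, Complex.normSq (T k j) : ℝ) : ℂ) := by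
  simp [Matrix.trace, Matrix.mul_apply, Complex.mul_conj]

theorem det_of_lower {m : Type*} [Fintype m] [LinearOrder m] {J : Matrix m m ℂ}
    (hJ : ∀ i j, i < j → J i j = 0) : J.det = ∏ k, J k k :=
  det_of_isLowerTriangular J fun i j h => hJ i j (by simpa using h)

theorem det_conjTranspose_mul_self_of_lower {m : Type*} [Fintype m] [LinearOrder m]
    {J : Matrix m m ℂ} (hJ : ∀ i j, i < j → J i j = 0) :
    (Jᴴ * J).det = ((∏ k, Complex.normSq (J k k) : ℝ) : ℂ) := by
  rw [det_mul, det_conjTranspose, det_of_lower hJ, star_prod, ← Finset.prod_mul_distrib]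
  push_cast
  exact Finset.prod_congr rfl fun k _ => by
    rw [Complex.normSq_eq_conj_mul_self]; rfl

theorem inv_lower {m : Type*} [Fintype m] [LinearOrder m] {L : Matrix m m ℂ}
    (hL : ∀ i j, i < j → L i j = 0) (hdet : IsUnit L.det) (i j : m) (hij : i < j) :
    L⁻¹ i j = 0 := by
  have : Invertible L := L.invertibleOfIsUnitDet hdet
  have h : L.BlockTriangular (OrderDual.toDual : m → mᵒᵈ) := fun i j h => hL i j (by simpa using h)
  exact blockTriangular_inv_of_blockTriangular h (by simpa using hij)

/-- Lower triangular with positive real diagonal. -/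
structure IsLowerPos {N : ℕ} (L : Matrix (Fin N) (Fin N) ℂ) : Prop where
  lower : ∀ i j, i < j → L i j = 0
  diag_im : ∀ i, (L i i).im = 0
  diag_pos : ∀ i, 0 < (L i i).re

namespace IsLowerPos

variable {N : ℕ} {L : Matrix (Fin N) (Fin N) ℂ}

theorem diag_ne_zero (hL : IsLowerPos L) (i : Fin N) : L i i ≠ 0 := fun h => by
  have := hL.diag_pos i
  simp [h] at this

theorem isUnit_det (hL : IsLowerPos L) : IsUnit L.det := by
  rw [det_of_lower hL.lower, isUnit_iff_ne_zero]
  exact Finset.prod_ne_zero_iff.2 fun i _ => hL.diag_ne_zero i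

theorem isUnit_det_childBlock (hL : IsLowerPos L) (ν : ℕ) : IsUnit (childBlock ν L).det := by
  have h : (childBlock ν L).det = ∏ k, childBlock ν L k k := by
    convert det_of_lower (J := childBlock ν L) fun i j h => hL.lower _ _ h
  rw [h, isUnit_iff_ne_zero]
  exact Finset.prod_ne_zero_iff.2 fun i _ => hL.diag_ne_zero i

/-- An invertible S⁻¹ has no zero row. Hence the square roots in Ω are positive and Ω never takes
the default value of a division by zero. -/
theorem rowNorm_pos (hL : IsLowerPos L) (ν : ℕ) (k : {i : Fin N // ¬ (i : ℕ) < ν}) :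
    0 < (((childBlock ν L)⁻¹ * ((childBlock ν L)⁻¹)ᴴ) k k).re := by
  have h1 : ((childBlock ν L)⁻¹).det ≠ 0 := by
    rw [det_nonsing_inv, ← isUnit_iff_ne_zero, isUnit_ringInverse]
    exact hL.isUnit_det_childBlock ν
  have h2 : ∃ j, (childBlock ν L)⁻¹ k j ≠ 0 := by
    by_contra! h
    exact h1 (det_eq_zero_of_row_eq_zero k h)
  obtain ⟨j, hj⟩ := h2
  have : (((childBlock ν L)⁻¹ * ((childBlock ν L)⁻¹)ᴴ) k k).re
      = ∑ j, Complex.normSq ((childBlock ν L)⁻¹ k j) := by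
    simp [Matrix.mul_apply, Complex.mul_conj]
  rw [this]
  exact Finset.sum_pos' (fun _ _ => Complex.normSq_nonneg _)
    ⟨j, Finset.mem_univ _, Complex.normSq_pos.2 hj⟩

end IsLowerPos

/-! ### The punctured factor and the optimization over `J`. -/

section entries

variable {N : ℕ} (ν : ℕ) (L : Matrix (Fin N) (Fin N) ℂ)

theorem puncturingMatrix_of_lt {i : Fin N} (hi : (i : ℕ) < ν) (j : Fin N) :
    puncturingMatrix ν L i j = if i = j then 1 else 0 := by
  by_cases hj : (j : ℕ) < ν
  · simp [puncturingMatrix, hi, hj, Matrix.one_apply]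
  · have : i ≠ j := fun h => hj (h ▸ hi)
    simp [puncturingMatrix, hi, hj, this]

theorem puncturingMatrix_of_not_lt_of_lt {i j : Fin N} (hi : ¬ (i : ℕ) < ν) (hj : (j : ℕ) < ν) :
    puncturingMatrix ν L i j = 0 := by
  simp [puncturingMatrix, hi, hj]

theorem puncturingMatrix_of_not_lt {i j : Fin N} (hi : ¬ (i : ℕ) < ν) (hj : ¬ (j : ℕ) < ν) :
    puncturingMatrix ν L i j =
      (puncturingScale (childBlock ν L) * (childBlock ν L)⁻¹) ⟨i, hi⟩ ⟨j, hj⟩ := by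
  simp [puncturingMatrix, hi, hj]

theorem puncture_of_lt {i : Fin N} (hi : (i : ℕ) < ν) (j : Fin N) :
    puncture ν L i j = L i j := by
  simp [puncture, Matrix.mul_apply, puncturingMatrix_of_lt ν L hi]

variable {L}

/-- Blockwise this is (Ω S⁻¹) S = Ω: a lower row of the puncturing matrix meets only the lower rows
of `L`. -/
theorem puncture_of_not_lt (hL : IsLowerPos L) {i j : Fin N} (hi : ¬ (i : ℕ) < ν) (hj : ¬ (j : ℕ) < ν) :
    puncture ν L i j = puncturingScale (childBlock ν L) ⟨i, hi⟩ ⟨j, hj⟩ := by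
  have h : puncturingScale (childBlock ν L) =
      (puncturingScale (childBlock ν L) * (childBlock ν L)⁻¹) * childBlock ν L := by
    rw [Matrix.mul_assoc, nonsing_inv_mul _ (hL.isUnit_det_childBlock ν), Matrix.mul_one]
  rw [h, puncture, Matrix.mul_apply, Matrix.mul_apply,
    ← (Equiv.sumCompl fun i : Fin N => (i : ℕ) < ν).sum_comp, Fintype.sum_sum_type]
  have h0 : ∑ l : {i : Fin N // (i : ℕ) < ν}, puncturingMatrix ν L i l * L l j = 0 :=
    Finset.sum_eq_zero fun l _ => by
      rw [puncturingMatrix_of_not_lt_of_lt ν L hi l.2, zero_mul]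
  simp only [Equiv.sumCompl_apply_inl, Equiv.sumCompl_apply_inr, h0, zero_add]
  exact Finset.sum_congr rfl fun l _ => by
    rw [puncturingMatrix_of_not_lt ν L hi l.2]; rfl

theorem puncture_lower (hL : IsLowerPos L) {i j : Fin N} (hij : i < j) : puncture ν L i j = 0 := by
  by_cases hi : (i : ℕ) < ν
  · rw [puncture_of_lt ν L hi, hL.lower _ _ hij]
  · have hj : ¬ (j : ℕ) < ν := fun h => hi (lt_trans hij h)
    rw [puncture_of_not_lt ν hL hi hj, puncturingScale, diagonal_apply_ne]
    simpa using hij.ne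

theorem isPunctured_puncture (hL : IsLowerPos L) : IsPunctured ν (puncture ν L) where
  lower _ _ := puncture_lower ν hL
  punctured k j hj hjk := by
    have hk : ¬ (k : ℕ) < ν := not_lt.2 (hj.trans (le_of_lt hjk))
    rw [puncture_of_not_lt ν hL hk (not_lt.2 hj), puncturingScale, diagonal_apply_ne]
    simpa using hjk.ne'
  diag_im k hk := by
    rw [puncture_of_not_lt ν hL (not_lt.2 hk) (not_lt.2 hk), puncturingScale, diagonal_apply_eq,
      Complex.ofReal_im]

theorem isLowerPos_puncture (hL : IsLowerPos L) : IsLowerPos (puncture ν L) where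
  lower _ _ := puncture_lower ν hL
  diag_im i := by
    by_cases hi : (i : ℕ) < ν
    · rw [puncture_of_lt ν L hi, hL.diag_im]
    · exact (isPunctured_puncture ν hL).diag_im i (not_lt.1 hi)
  diag_pos i := by
    by_cases hi : (i : ℕ) < ν
    · rw [puncture_of_lt ν L hi]; exact hL.diag_pos i
    · rw [puncture_of_not_lt ν hL hi hi, puncturingScale, diagonal_apply_eq, Complex.ofReal_re]
      have := hL.rowNorm_pos ν ⟨i, hi⟩
      positivity

/-- The exponent -1/2 in Ω is exactly what normalizes the rows of S⁻¹; the upper rows are unit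
vectors already. -/
theorem sum_normSq_puncturingMatrix (hL : IsLowerPos L) (k : Fin N) :
    ∑ j, Complex.normSq (puncturingMatrix ν L k j) = 1 := by
  by_cases hk : (k : ℕ) < ν
  · simp [puncturingMatrix_of_lt ν L hk, apply_ite Complex.normSq]
  · rw [← (Equiv.sumCompl fun i : Fin N => (i : ℕ) < ν).sum_comp, Fintype.sum_sum_type]
    have h0 : ∑ l : {i : Fin N // (i : ℕ) < ν},
        Complex.normSq (puncturingMatrix ν L k l) = 0 :=
      Finset.sum_eq_zero fun l _ => by
        rw [puncturingMatrix_of_not_lt_of_lt ν L hk l.2, map_zero]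
    simp only [Equiv.sumCompl_apply_inl, Equiv.sumCompl_apply_inr, h0, zero_add]
    have h1 := hL.rowNorm_pos ν ⟨k, hk⟩
    have h2 : (((childBlock ν L)⁻¹ * ((childBlock ν L)⁻¹)ᴴ) ⟨k, hk⟩ ⟨k, hk⟩).re
        = ∑ j, Complex.normSq ((childBlock ν L)⁻¹ ⟨k, hk⟩ j) := by
      simp [Matrix.mul_apply, Complex.mul_conj]
    have h3 : ∀ l : {i : Fin N // ¬ (i : ℕ) < ν},
        Complex.normSq (puncturingMatrix ν L k l) =
          (((childBlock ν L)⁻¹ * ((childBlock ν L)⁻¹)ᴴ) ⟨k, hk⟩ ⟨k, hk⟩).re⁻¹ *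
            Complex.normSq ((childBlock ν L)⁻¹ ⟨k, hk⟩ l) := fun l => by
      rw [puncturingMatrix_of_not_lt ν L hk l.2, puncturingScale, diagonal_mul, map_mul,
        Complex.normSq_ofReal, div_mul_div_comm, one_mul,
        Real.mul_self_sqrt h1.le, one_div]
    simp_rw [h3]
    rw [← Finset.mul_sum, ← h2, inv_mul_cancel₀ h1.ne']

/-- The rows of `(J - C * puncture ν L) * L⁻¹`, `C` matching the diagonals, are supported away from
those of the puncturing matrix. -/
theorem residual_eq_zero (hL : IsLowerPos L) {J : Matrix (Fin N) (Fin N) ℂ} (hJ : IsPunctured ν J)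
    {E : Matrix (Fin N) (Fin N) ℂ}
    (hE : E = (J - diagonal (fun k => J k k / puncture ν L k k) * puncture ν L) * L⁻¹)
    {k j : Fin N} (h : ¬ (j < k ∧ (j : ℕ) < ν)) : E k j = 0 := by
  have hp := isPunctured_puncture ν hL
  have hd := (isLowerPos_puncture ν hL).diag_ne_zero
  rw [hE, Matrix.mul_apply]
  refine Finset.sum_eq_zero fun l _ => ?_
  -- Since L⁻¹ is lower triangular, only l ≥ j contributes. There the first factor vanishes: above
  -- the diagonal by triangularity, on it by the choice of ratios, and below it because the excluded
  -- region forces ν ≤ l, where both matrices are punctured.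
  by_cases hl : l < j
  · rw [inv_lower hL.lower hL.isUnit_det l j hl, mul_zero]
  · have : (J - diagonal (fun k => J k k / puncture ν L k k) * puncture ν L) k l = 0 := by
      rw [Matrix.sub_apply, diagonal_mul]
      rcases lt_trichotomy k l with h1 | h1 | h1
      · rw [hJ.lower _ _ h1, hp.lower _ _ h1, mul_zero, sub_zero]
      · subst h1
        rw [div_mul_cancel₀ _ (hd _), sub_self]
      · have h2 : ν ≤ (l : ℕ) := by
          have h3 : j ≤ l := not_lt.1 hl
          by_contra! h4
          exact h ⟨lt_of_le_of_lt h3 h1, lt_of_le_of_lt h3 h4⟩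
        rw [hJ.punctured _ _ h2 h1, hp.punctured _ _ h2 h1, mul_zero, sub_zero]
    rw [this, zero_mul]

/-- Pythagoras without cross terms: J L⁻¹ = C P + E, and at every entry P or E is zero. -/
theorem normSq_mul_inv_apply (hL : IsLowerPos L) {J : Matrix (Fin N) (Fin N) ℂ} (hJ : IsPunctured ν J)
    {E : Matrix (Fin N) (Fin N) ℂ}
    (hE : E = (J - diagonal (fun k => J k k / puncture ν L k k) * puncture ν L) * L⁻¹)
    (k j : Fin N) :
    Complex.normSq ((J * L⁻¹) k j) =
      Complex.normSq (J k k / puncture ν L k k) * Complex.normSq (puncturingMatrix ν L k j) +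
        Complex.normSq (E k j) := by
  have h1 : J * L⁻¹ = diagonal (fun k => J k k / puncture ν L k k) * puncturingMatrix ν L + E := by
    rw [hE, Matrix.sub_mul, puncture, Matrix.mul_assoc, Matrix.mul_assoc,
      mul_nonsing_inv _ hL.isUnit_det, Matrix.mul_one]
    abel
  rw [h1, Matrix.add_apply, diagonal_mul]
  by_cases h : j < k ∧ (j : ℕ) < ν
  · have : puncturingMatrix ν L k j = 0 := by
      by_cases hk : (k : ℕ) < ν
      · rw [puncturingMatrix_of_lt ν L hk, if_neg h.1.ne']
      · exact puncturingMatrix_of_not_lt_of_lt ν L hk h.2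
    simp [this]
  · rw [residual_eq_zero ν hL hJ hE h]
    simp

/-- Cyclicity of the trace turns the linear functional of the Gram matrix into the squared Frobenius
norm of J L⁻¹, which splits over rows. -/
theorem trace_gram_mul_inv (J : Matrix (Fin N) (Fin N) ℂ) :
    (Jᴴ * J * (Lᴴ * L)⁻¹).trace = ((∑ k, ∑ j, Complex.normSq ((J * L⁻¹) k j) : ℝ) : ℂ) := by
  rw [← trace_mul_conjTranspose_eq_sum_normSq, Matrix.mul_inv_rev, conjTranspose_mul,
    conjTranspose_nonsing_inv, Matrix.mul_assoc, Matrix.trace_mul_comm]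
  simp only [Matrix.mul_assoc]

theorem trace_gram_puncture_mul_inv (hL : IsLowerPos L) :
    ((puncture ν L)ᴴ * puncture ν L * (Lᴴ * L)⁻¹).trace.re = N := by
  rw [trace_gram_mul_inv, Complex.ofReal_re]
  have : puncture ν L * L⁻¹ = puncturingMatrix ν L := by
    rw [puncture, Matrix.mul_assoc, mul_nonsing_inv _ hL.isUnit_det, Matrix.mul_one]
  simp [this, sum_normSq_puncturingMatrix ν hL]

/-- Among punctured `J`, `log det (J†J) - tr (J†J (L†L)⁻¹)` is largest exactly at the Gram matrix
of `puncture ν L`. -/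
theorem log_det_sub_trace_le (hL : IsLowerPos L) {J : Matrix (Fin N) (Fin N) ℂ} (hJ : IsPunctured ν J)
    (hdet : J.det ≠ 0) :
    Real.log (Jᴴ * J).det.re - (Jᴴ * J * (Lᴴ * L)⁻¹).trace.re ≤
        Real.log ((puncture ν L)ᴴ * puncture ν L).det.re - N ∧
      (Real.log (Jᴴ * J).det.re - (Jᴴ * J * (Lᴴ * L)⁻¹).trace.re =
        Real.log ((puncture ν L)ᴴ * puncture ν L).det.re - N →
        Jᴴ * J = (puncture ν L)ᴴ * puncture ν L) := by
  obtain ⟨E, hE⟩ : ∃ E, E =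
    (J - diagonal (fun k => J k k / puncture ν L k k) * puncture ν L) * L⁻¹ := ⟨_, rfl⟩
  set c : Fin N → ℂ := fun k => J k k / puncture ν L k k with hc
  have hp := isLowerPos_puncture ν hL
  have hJd : ∀ k, J k k ≠ 0 := by
    rw [det_of_lower hJ.lower] at hdet
    exact fun k => Finset.prod_ne_zero_iff.1 hdet k (Finset.mem_univ _)
  have hcpos : ∀ k, 0 < Complex.normSq (c k) := fun k =>
    Complex.normSq_pos.2 (div_ne_zero (hJd k) (hp.diag_ne_zero k))
  have h1 : (Jᴴ * J * (Lᴴ * L)⁻¹).trace.re =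
      ∑ k, Complex.normSq (c k) + ∑ k, ∑ j, Complex.normSq (E k j) := by
    rw [trace_gram_mul_inv, Complex.ofReal_re, ← Finset.sum_add_distrib]
    refine Finset.sum_congr rfl fun k _ => ?_
    simp_rw [normSq_mul_inv_apply ν hL hJ hE]
    rw [Finset.sum_add_distrib, ← Finset.mul_sum, sum_normSq_puncturingMatrix ν hL, mul_one]
  have h2 : Real.log (Jᴴ * J).det.re = Real.log ((puncture ν L)ᴴ * puncture ν L).det.re +
      ∑ k, Real.log (Complex.normSq (c k)) := by
    rw [det_conjTranspose_mul_self_of_lower hJ.lower,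
      det_conjTranspose_mul_self_of_lower hp.lower, Complex.ofReal_re, Complex.ofReal_re,
      Real.log_prod fun k _ => (Complex.normSq_pos.2 (hJd k)).ne',
      Real.log_prod fun k _ => (Complex.normSq_pos.2 (hp.diag_ne_zero k)).ne',
      ← Finset.sum_add_distrib]
    refine Finset.sum_congr rfl fun k _ => ?_
    rw [← Real.log_mul (Complex.normSq_pos.2 (hp.diag_ne_zero k)).ne' (hcpos k).ne', ← map_mul,
      hc, mul_div_cancel₀ _ (hp.diag_ne_zero k)]
  -- The gap to the optimum is Σ(|c_k|² - 1 - log|c_k|²) + ‖E‖². Every summand is nonnegative, so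
  -- equality kills each of them.
  have h3 : ∑ k, (Complex.normSq (c k) - 1 - Real.log (Complex.normSq (c k))) =
      ∑ k, Complex.normSq (c k) - N - ∑ k, Real.log (Complex.normSq (c k)) := by
    simp [Finset.sum_sub_distrib]
  have h4 : ∀ k ∈ Finset.univ,
      0 ≤ Complex.normSq (c k) - 1 - Real.log (Complex.normSq (c k)) := fun k _ => by
    linarith [Real.log_le_sub_one_of_pos (hcpos k)]
  have h5 : ∀ k ∈ Finset.univ, 0 ≤ ∑ j, Complex.normSq (E k j) := fun k _ =>
    Finset.sum_nonneg fun _ _ => Complex.normSq_nonneg _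
  have h6 := Finset.sum_nonneg h4
  have h7 := Finset.sum_nonneg h5
  refine ⟨by rw [h1, h2]; linarith, fun heq => ?_⟩
  rw [h1, h2] at heq
  have h8 := (Finset.sum_eq_zero_iff_of_nonneg h4).1 (by linarith)
  have h9 := (Finset.sum_eq_zero_iff_of_nonneg h5).1 (by linarith)
  have hc1 : ∀ k, Complex.normSq (c k) = 1 := fun k => by
    by_contra hne
    linarith [Real.log_lt_sub_one_of_pos (hcpos k) hne, h8 k (Finset.mem_univ _)]
  have hE0 : E = 0 := by
    ext k j
    have := (Finset.sum_eq_zero_iff_of_nonneg fun j _ => Complex.normSq_nonneg (E k j)).1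
      (h9 k (Finset.mem_univ _)) j (Finset.mem_univ _)
    exact Complex.normSq_eq_zero.1 this
  -- E = 0 multiplied by L determines J up to the diagonal C, which is unitary and so cancels in
  -- J†J.
  have hJe : J = diagonal c * puncture ν L := by
    rw [← sub_eq_zero, ← Matrix.mul_one (J - _), ← nonsing_inv_mul _ hL.isUnit_det,
      ← Matrix.mul_assoc, ← hE, hE0, Matrix.zero_mul]
  have hcc : (diagonal c)ᴴ * diagonal c = 1 := by
    rw [diagonal_conjTranspose, diagonal_mul_diagonal, ← diagonal_one]
    congr 1
    ext k
    have := Complex.normSq_eq_conj_mul_self (z := c k)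
    rw [hc1 k] at this
    simpa using this.symm
  conv_lhs => rw [hJe]
  rw [conjTranspose_mul, Matrix.mul_assoc, ← Matrix.mul_assoc _ (diagonal c), hcc, Matrix.one_mul]

end entries

/-! ### One-dimensional complex Gaussian integrals. -/

/-- The closed formula for the integral is positive, whereas a non-integrable function has integral
0 by convention. -/
theorem integrable_norm_pow_mul_exp {b : ℝ} (hb : 0 < b) (n : ℕ) :
    Integrable fun z : ℂ => ‖z‖ ^ n * Real.exp (-b * ‖z‖ ^ 2) := by
  have h := Complex.integral_rpow_mul_exp_neg_mul_rpow (p := 2) (q := n) (b := b) (by norm_num)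
    (by have : (0 : ℝ) ≤ n := n.cast_nonneg
        linarith) hb
  have hpos : 0 < (2 * Real.pi / 2) * b ^ (-((n : ℝ) + 2) / 2) * Real.Gamma (((n : ℝ) + 2) / 2) := by
    have := Real.Gamma_pos_of_pos (s := ((n : ℝ) + 2) / 2) (by positivity)
    have := Real.pi_pos
    positivity
  rw [← h] at hpos
  have := not_imp_comm.1 integral_undef hpos.ne'
  simpa using this

theorem integral_exp_neg_mul_norm_sq {b : ℝ} (hb : 0 < b) :
    ∫ z : ℂ, Real.exp (-b * ‖z‖ ^ 2) = Real.pi / b := by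
  have h := Complex.integral_rpow_mul_exp_neg_mul_rpow (p := 2) (q := 0) (b := b) (by norm_num)
    (by norm_num) hb
  simp only [Real.rpow_zero, one_mul, zero_add, Real.rpow_two] at h
  rw [h]
  norm_num [Real.rpow_neg_one]
  ring

theorem integral_norm_sq_mul_exp {b : ℝ} (hb : 0 < b) :
    ∫ z : ℂ, ‖z‖ ^ 2 * Real.exp (-b * ‖z‖ ^ 2) = Real.pi / b ^ 2 := by
  have h := Complex.integral_rpow_mul_exp_neg_mul_rpow (p := 2) (q := 2) (b := b) (by norm_num)
    (by norm_num) hb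
  simp only [Real.rpow_two] at h
  rw [h]
  norm_num [Real.rpow_neg hb.le]
  ring

/-- The density of the one-dimensional law `CN(0, v)`. -/
noncomputable def gaussianDensity (v : ℝ) (z : ℂ) : ℝ :=
  1 / (Real.pi * v) * Real.exp (-v⁻¹ * ‖z‖ ^ 2)

theorem gaussianDensity_nonneg {v : ℝ} (hv : 0 < v) (z : ℂ) : 0 ≤ gaussianDensity v z := by
  have := Real.pi_pos
  unfold gaussianDensity
  positivity

@[fun_prop]
theorem continuous_gaussianDensity (v : ℝ) : Continuous (gaussianDensity v) := by
  unfold gaussianDensity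
  fun_prop

theorem prod_gaussianDensity {n : ℕ} (v : ℝ) (x : Fin n → ℂ) :
    ∏ k, gaussianDensity v (x k) =
      1 / (Real.pi * v) ^ n * Real.exp (-(∑ i, ‖x i‖ ^ 2) / v) := by
  simp only [gaussianDensity, Finset.prod_mul_distrib, ← Real.exp_sum, ← Finset.mul_sum]
  simp only [Finset.prod_const, Finset.card_univ, Fintype.card_fin, one_div, inv_pow]
  congr 2
  ring

theorem integrable_gaussianDensity_mul {v : ℝ} (hv : 0 < v) {h : ℂ → ℂ} (hm : Continuous h) (n : ℕ)
    (hh : ∀ z, ‖h z‖ = ‖z‖ ^ n) : Integrable fun z => (gaussianDensity v z : ℂ) * h z := by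
  refine ((integrable_norm_pow_mul_exp (inv_pos.2 hv) n).const_mul (1 / (Real.pi * v))).mono'
    (by fun_prop) (.of_forall fun z => ?_)
  rw [norm_mul, hh, Complex.norm_real, Real.norm_of_nonneg (gaussianDensity_nonneg hv z),
    gaussianDensity]
  exact le_of_eq (by ring)

theorem integral_gaussianDensity {v : ℝ} (hv : 0 < v) :
    ∫ z, (gaussianDensity v z : ℂ) = 1 := by
  rw [integral_complex_ofReal]
  simp only [gaussianDensity]
  rw [integral_const_mul, integral_exp_neg_mul_norm_sq (inv_pos.2 hv)]
  have := Real.pi_pos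
  norm_cast
  field_simp

theorem integral_gaussianDensity_mul_conj_mul {v : ℝ} (hv : 0 < v) :
    ∫ z, (gaussianDensity v z : ℂ) * (star z * z) = v := by
  have : ∀ z : ℂ, (gaussianDensity v z : ℂ) * (star z * z) =
      ((1 / (Real.pi * v) * (‖z‖ ^ 2 * Real.exp (-v⁻¹ * ‖z‖ ^ 2)) : ℝ) : ℂ) := fun z => by
    have h : star z * z = ((‖z‖ ^ 2 : ℝ) : ℂ) := by
      rw [← Complex.normSq_eq_norm_sq, Complex.normSq_eq_conj_mul_self]; rfl
    rw [h, ← Complex.ofReal_mul, gaussianDensity]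
    congr 1
    ring
  simp_rw [this]
  rw [integral_complex_ofReal, integral_const_mul, integral_norm_sq_mul_exp (inv_pos.2 hv)]
  have := Real.pi_pos
  norm_cast
  field_simp

theorem integral_eq_zero_of_odd {f : ℂ → ℂ} (hf : ∀ z, f (-z) = -f z) : ∫ z, f z = 0 := by
  have h := integral_neg_eq_self f volume
  simp_rw [hf] at h
  rw [integral_neg] at h
  linear_combination (-1 / 2 : ℂ) * h

theorem gaussianDensity_neg (v : ℝ) (z : ℂ) : gaussianDensity v (-z) = gaussianDensity v z := by
  simp [gaussianDensity]

/-! ### First and second moments of the Gaussian vector. -/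

section moments

variable {n : ℕ} {v : ℝ}

/-- The density factors over the coordinates. The moments below take each factor to be a coordinate,
its conjugate, their product, or 1. -/
theorem integral_prod_complexGaussian (hv : 0 < v) {h : Fin n → ℂ → ℂ} :
    ∫ x, ∏ k, h k (x k) ∂(complexGaussian n v) =
      ∏ k, ∫ z, (gaussianDensity v z : ℂ) * h k z := by
  rw [complexGaussian, integral_withDensity_eq_integral_toReal_smul (by fun_prop) (by simp),
    ← integral_fintype_prod_volume_eq_prod]
  refine integral_congr_ae (.of_forall fun x => ?_)
  simp only
  rw [← prod_gaussianDensity, ENNReal.toReal_ofReal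
    (Finset.prod_nonneg fun k _ => gaussianDensity_nonneg hv _), Finset.prod_mul_distrib,
    Complex.real_smul]
  push_cast
  rfl

theorem integrable_prod_complexGaussian (hv : 0 < v) {h : Fin n → ℂ → ℂ}
    (hh : ∀ k, Integrable fun z => (gaussianDensity v z : ℂ) * h k z) :
    Integrable (fun x => ∏ k, h k (x k)) (complexGaussian n v) := by
  rw [complexGaussian, integrable_withDensity_iff_integrable_smul' (by fun_prop) (by simp)]
  refine (Integrable.fintype_prod hh).congr (.of_forall fun x => ?_)
  simp only
  rw [← prod_gaussianDensity, ENNReal.toReal_ofReal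
    (Finset.prod_nonneg fun k _ => gaussianDensity_nonneg hv _), Finset.prod_mul_distrib,
    Complex.real_smul]
  push_cast
  rfl

theorem isProbabilityMeasure_complexGaussian (hv : 0 < v) :
    IsProbabilityMeasure (complexGaussian n v) := by
  -- Integrating 1 gives the total mass as a real number. The value 1 also excludes infinite mass,
  -- whose `toReal` is 0.
  have h1 := integral_prod_complexGaussian (n := n) hv (h := fun _ _ => 1)
  simp only [Finset.prod_const_one, mul_one, integral_gaussianDensity hv] at h1
  rw [integral_const, Complex.real_smul, mul_one] at h1
  have h2 : (complexGaussian n v).real Set.univ = 1 := by exact_mod_cast h1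
  refine ⟨?_⟩
  rw [Measure.real] at h2
  exact (ENNReal.toReal_eq_one_iff _).1 h2

theorem integrable_coord (hv : 0 < v) (j : Fin n) :
    Integrable (fun x => x j) (complexGaussian n v) := by
  have := integrable_prod_complexGaussian (n := n) hv (h := fun k z => if k = j then z else 1)
    fun k => by
      by_cases h : k = j
      · simpa [h] using integrable_gaussianDensity_mul hv continuous_id 1 (by simp)
      · simpa [h] using integrable_gaussianDensity_mul hv (h := fun _ => 1) continuous_const 0
          (by simp)
  simpa using this

theorem integral_coord (hv : 0 < v) (j : Fin n) :
    ∫ x, x j ∂(complexGaussian n v) = 0 := by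
  have := integral_prod_complexGaussian (n := n) hv (h := fun k z => if k = j then z else 1)
  rw [Finset.prod_eq_zero (Finset.mem_univ j)] at this
  · simpa using this
  · simp only [if_true]
    exact integral_eq_zero_of_odd fun z => by rw [gaussianDensity_neg]; ring

theorem integrable_star_mul_coord (hv : 0 < v) (i j : Fin n) :
    Integrable (fun x => star (x i) * x j) (complexGaussian n v) := by
  have := integrable_prod_complexGaussian (n := n) hv
    (h := fun k z => (if k = i then star z else 1) * (if k = j then z else 1)) fun k => by
      by_cases hi : k = i <;> by_cases hj : k = j
      · simp only [if_pos hi, if_pos hj]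
        exact integrable_gaussianDensity_mul hv (h := fun z => star z * z)
          (by fun_prop) 2 (by simp [sq])
      · simp only [if_pos hi, if_neg hj, mul_one]
        exact integrable_gaussianDensity_mul hv (h := fun z => star z) (by fun_prop) 1 (by simp)
      · simp only [if_neg hi, if_pos hj, one_mul]
        exact integrable_gaussianDensity_mul hv (h := fun z => z) (by fun_prop) 1 (by simp)
      · simpa [hi, hj] using integrable_gaussianDensity_mul hv (h := fun _ => 1) continuous_const 0
          (by simp)
  simp_rw [Finset.prod_mul_distrib] at this
  simpa using this

theorem integral_star_mul_coord (hv : 0 < v) (i j : Fin n) :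
    ∫ x, star (x i) * x j ∂(complexGaussian n v) = if i = j then (v : ℂ) else 0 := by
  have := integral_prod_complexGaussian (n := n) hv
    (h := fun k z => (if k = i then star z else 1) * (if k = j then z else 1))
  have h2 : ∫ x, star (x i) * x j ∂(complexGaussian n v) =
      ∫ x, ∏ k, (if k = i then star (x k) else 1) * (if k = j then x k else 1)
        ∂(complexGaussian n v) := by
    simp_rw [Finset.prod_mul_distrib]
    simp
  rw [h2, this]
  by_cases hij : i = j
  · subst hij
    rw [if_pos rfl, Finset.prod_eq_single i]
    · simpa using integral_gaussianDensity_mul_conj_mul hv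
    · intro k _ hk
      simpa [hk] using integral_gaussianDensity hv
    · simp
  · rw [if_neg hij]
    refine Finset.prod_eq_zero (Finset.mem_univ j) ?_
    simp only [if_neg (Ne.symm hij), if_true, one_mul]
    exact integral_eq_zero_of_odd fun z => by rw [gaussianDensity_neg]; ring

end moments

/-! ### The mismatched output density as a Gaussian integral. -/

open scoped MatrixOrder Matrix.Norms.L2Operator in
theorem exists_eq_conjTranspose_mul_self {n : Type*} [Fintype n] [DecidableEq n]
    {G : Matrix n n ℂ} (hG : G.PosSemidef) : ∃ J : Matrix n n ℂ, G = Jᴴ * J :=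
  CStarAlgebra.nonneg_iff_eq_star_mul_self.mp hG.nonneg

section gaussianIntegral

variable {M N : ℕ}

theorem lintegral_exp_neg_sum_norm_sq :
    ∫⁻ x : Fin N → ℂ, ENNReal.ofReal (Real.exp (-∑ i, ‖x i‖ ^ 2)) =
      ENNReal.ofReal (Real.pi ^ N) := by
  have h : ∀ x : Fin N → ℂ, Real.exp (-∑ i, ‖x i‖ ^ 2) = ∏ i, Real.exp (-1 * ‖x i‖ ^ 2) :=
    fun x => by rw [← Real.exp_sum, ← Finset.mul_sum, neg_one_mul]
  simp_rw [h]
  rw [← ofReal_integral_eq_lintegral_ofReal]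
  · rw [integral_fintype_prod_volume_eq_pow (fun z : ℂ => Real.exp (-1 * ‖z‖ ^ 2)),
      integral_exp_neg_mul_norm_sq one_pos]
    simp
  · exact Integrable.fintype_prod (f := fun _ z => Real.exp (-1 * ‖z‖ ^ 2)) fun _ => by
      simpa using integrable_norm_pow_mul_exp one_pos 0
  · exact .of_forall fun x => Finset.prod_nonneg fun _ _ => (Real.exp_pos _).le

/-- The Jacobian is the determinant of `J` as a real linear map, namely |det J|², the norm from ℂ to
ℝ of the complex determinant. -/
theorem lintegral_comp_mulVec {J : Matrix (Fin N) (Fin N) ℂ} (hJ : J.det ≠ 0)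
    {f : (Fin N → ℂ) → ℝ≥0∞} (hf : Measurable f) :
    ∫⁻ x, f (J *ᵥ x) = ENNReal.ofReal (Complex.normSq J.det)⁻¹ * ∫⁻ x, f x := by
  have hd : LinearMap.det ((Matrix.toLin' J).restrictScalars ℝ) = Complex.normSq J.det := by
    rw [LinearMap.det_restrictScalars, LinearMap.det_toLin', Algebra.norm_complex_apply]
  have h := Measure.map_linearMap_addHaar_eq_smul_addHaar (volume : Measure (Fin N → ℂ))
    (f := (Matrix.toLin' J).restrictScalars ℝ) (by rw [hd]; simpa using hJ)
  have hm : Measurable ((Matrix.toLin' J).restrictScalars ℝ) :=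
    (LinearMap.continuous_of_finiteDimensional _).measurable
  have h2 := lintegral_map (μ := volume) hf hm
  rw [h, lintegral_smul_measure, hd,
    abs_of_nonneg (inv_nonneg.2 (Complex.normSq_nonneg _)), smul_eq_mul] at h2
  rw [h2]
  rfl

/-- With w = J⁻†F†y the linear term is 2 Re(w†Jx), and ‖w‖² is the constant left over. -/
theorem complete_square (F : Matrix (Fin M) (Fin N) ℂ) {J : Matrix (Fin N) (Fin N) ℂ}
    (hJ : J.det ≠ 0) (y : Fin M → ℂ) (x : Fin N → ℂ) :
    2 * (star y ⬝ᵥ (F *ᵥ x)).re - (star x ⬝ᵥ ((Jᴴ * J) *ᵥ x)).re =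
      (star y ⬝ᵥ ((F * (Jᴴ * J)⁻¹ * Fᴴ) *ᵥ y)).re -
        ∑ i, ‖(J *ᵥ x + -((Jᴴ)⁻¹ *ᵥ (Fᴴ *ᵥ y))) i‖ ^ 2 := by
  obtain ⟨w, hw⟩ : ∃ w, w = (Jᴴ)⁻¹ *ᵥ (Fᴴ *ᵥ y) := ⟨_, rfl⟩
  have hu : IsUnit (Jᴴ).det := by
    rw [det_conjTranspose, isUnit_iff_ne_zero]; simpa using hJ
  have hu' : IsUnit J.det := isUnit_iff_ne_zero.2 hJ
  have h1 : Jᴴ *ᵥ w = Fᴴ *ᵥ y := by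
    rw [hw, mulVec_mulVec, mul_nonsing_inv _ hu, one_mulVec]
  have hs : ∀ u : Fin N → ℂ, ((∑ i, ‖u i‖ ^ 2 : ℝ) : ℂ) = star u ⬝ᵥ u := fun u => by
    rw [dotProduct]
    push_cast
    refine Finset.sum_congr rfl fun i _ => ?_
    rw [← Complex.ofReal_pow, ← Complex.normSq_eq_norm_sq, Complex.normSq_eq_conj_mul_self]; rfl
  have h2 : star y ⬝ᵥ (F *ᵥ x) = star w ⬝ᵥ (J *ᵥ x) := by
    have : star y ᵥ* F = star w ᵥ* J := by
      have := congrArg star h1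
      rw [star_mulVec, star_mulVec, conjTranspose_conjTranspose, conjTranspose_conjTranspose]
        at this
      exact this.symm
    rw [dotProduct_mulVec, this, ← dotProduct_mulVec]
  have h3 : star x ⬝ᵥ ((Jᴴ * J) *ᵥ x) = star (J *ᵥ x) ⬝ᵥ (J *ᵥ x) := by
    rw [← mulVec_mulVec, dotProduct_mulVec, ← star_mulVec]
  have h4 : star y ⬝ᵥ ((F * (Jᴴ * J)⁻¹ * Fᴴ) *ᵥ y) = star w ⬝ᵥ w := by
    rw [Matrix.mul_inv_rev, hw, star_mulVec, star_mulVec, conjTranspose_nonsing_inv]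
    simp only [conjTranspose_conjTranspose, ← mulVec_mulVec, dotProduct_mulVec, vecMul_vecMul,
      Matrix.mul_assoc]
  have h5 : ∑ i, ‖(J *ᵥ x + -w) i‖ ^ 2 = (star (J *ᵥ x + -w) ⬝ᵥ (J *ᵥ x + -w)).re := by
    rw [← hs, Complex.ofReal_re]
  have h6 : (star (J *ᵥ x) ⬝ᵥ w).re = (star w ⬝ᵥ (J *ᵥ x)).re := by
    rw [← Complex.conj_re, ← Complex.star_def, ← star_dotProduct_star, star_star, dotProduct_comm]
  rw [← hw, h5, h2, h3, h4]
  simp only [star_add, star_neg, add_dotProduct, dotProduct_add, neg_dotProduct, dotProduct_neg,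
    Complex.add_re, Complex.neg_re, h6]
  ring

theorem lintegral_exp_quadratic (F : Matrix (Fin M) (Fin N) ℂ) {G : Matrix (Fin N) (Fin N) ℂ}
    (hG : G.PosDef) (y : Fin M → ℂ) :
    ∫⁻ x, ENNReal.ofReal
        (Real.exp (2 * (star y ⬝ᵥ (F *ᵥ x)).re - (star x ⬝ᵥ (G *ᵥ x)).re)) =
      ENNReal.ofReal (Real.pi ^ N / G.det.re *
        Real.exp (star y ⬝ᵥ ((F * G⁻¹ * Fᴴ) *ᵥ y)).re) := by
  obtain ⟨J, hJ⟩ := exists_eq_conjTranspose_mul_self hG.posSemidef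
  have hd : G.det = ((Complex.normSq J.det : ℝ) : ℂ) := by
    rw [hJ, det_mul, det_conjTranspose, Complex.normSq_eq_conj_mul_self]; rfl
  have hJd : J.det ≠ 0 := fun h => by
    have := (hG.posSemidef.posDef_iff_det_ne_zero).1 hG
    rw [hd, h] at this
    simp at this
  set w := (Jᴴ)⁻¹ *ᵥ (Fᴴ *ᵥ y) with hw
  set q := (star y ⬝ᵥ ((F * G⁻¹ * Fᴴ) *ᵥ y)).re with hq
  have h1 : ∀ x, ENNReal.ofReal
      (Real.exp (2 * (star y ⬝ᵥ (F *ᵥ x)).re - (star x ⬝ᵥ (G *ᵥ x)).re)) =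
      ENNReal.ofReal (Real.exp q) *
        ENNReal.ofReal (Real.exp (-∑ i, ‖(J *ᵥ x + -w) i‖ ^ 2)) := fun x => by
    rw [← ENNReal.ofReal_mul (Real.exp_pos _).le, ← Real.exp_add, hJ, complete_square F hJd y x,
      ← hw, hq, hJ, sub_eq_add_neg]
  simp_rw [h1]
  rw [lintegral_const_mul _ (by fun_prop),
    lintegral_comp_mulVec hJd
      (f := fun u => ENNReal.ofReal (Real.exp (-∑ i, ‖(u + -w) i‖ ^ 2))) (by fun_prop),
    lintegral_add_right_eq_self
      (fun u : Fin N → ℂ => ENNReal.ofReal (Real.exp (-∑ i, ‖u i‖ ^ 2))) (-w),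
    lintegral_exp_neg_sum_norm_sq,
    ← ENNReal.ofReal_mul (inv_nonneg.2 (Complex.normSq_nonneg _)),
    ← ENNReal.ofReal_mul (Real.exp_pos _).le, hd, Complex.ofReal_re]
  congr 1
  ring

theorem re_det_pos {G : Matrix (Fin N) (Fin N) ℂ} (hG : G.PosDef) : 0 < G.det.re :=
  (Complex.pos_iff.1 hG.det_pos).1

/-- Replacing G by G + εI shrinks the integrand and makes the form positive definite. The resulting
integral is at least πᴺ / det(G + εI), because the exponent produced by `F` is nonnegative, and this
bound diverges as ε → 0⁺. -/
theorem lintegral_exp_quadratic_eq_top (F : Matrix (Fin M) (Fin N) ℂ)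
    {G : Matrix (Fin N) (Fin N) ℂ} (hG : G.PosSemidef) (hdet : G.det = 0) (y : Fin M → ℂ) :
    ∫⁻ x, ENNReal.ofReal
        (Real.exp (2 * (star y ⬝ᵥ (F *ᵥ x)).re - (star x ⬝ᵥ (G *ᵥ x)).re)) = ⊤ := by
  have hpd : ∀ ε : ℝ, 0 < ε → (G + (ε : ℂ) • (1 : Matrix (Fin N) (Fin N) ℂ)).PosDef := fun ε hε =>
    PosDef.posSemidef_add hG (PosDef.one.smul (by exact_mod_cast hε))
  have hle : ∀ ε : ℝ, 0 < ε →
      ENNReal.ofReal (Real.pi ^ N *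
        ((G + (ε : ℂ) • (1 : Matrix (Fin N) (Fin N) ℂ)).det.re)⁻¹) ≤
      ∫⁻ x, ENNReal.ofReal
        (Real.exp (2 * (star y ⬝ᵥ (F *ᵥ x)).re - (star x ⬝ᵥ (G *ᵥ x)).re)) := fun ε hε => by
    have h1 := lintegral_exp_quadratic F (hpd ε hε) y
    have h2 : 0 ≤ (star y ⬝ᵥ
        ((F * (G + (ε : ℂ) • (1 : Matrix (Fin N) (Fin N) ℂ))⁻¹ * Fᴴ) *ᵥ y)).re :=
      (Complex.nonneg_iff.1
        (((hpd ε hε).inv.posSemidef.mul_mul_conjTranspose_same F).dotProduct_mulVec_nonneg y)).1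
    have h3 := re_det_pos (hpd ε hε)
    calc _ ≤ _ := ENNReal.ofReal_le_ofReal (by
            rw [← div_eq_mul_inv]
            exact le_mul_of_one_le_right
              (div_nonneg (pow_pos Real.pi_pos N).le h3.le) (Real.one_le_exp h2))
      _ = _ := h1.symm
      _ ≤ _ := lintegral_mono fun x => ENNReal.ofReal_le_ofReal (Real.exp_le_exp.2 (by
            have h4 : 0 ≤ (star x ⬝ᵥ x).re :=
              (Complex.nonneg_iff.1 (dotProduct_star_self_nonneg x)).1
            rw [add_mulVec, dotProduct_add, smul_mulVec, one_mulVec, dotProduct_smul,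
              Complex.add_re, smul_eq_mul, Complex.re_ofReal_mul]
            nlinarith [mul_nonneg hε.le h4]))
  have hcont : Continuous fun ε : ℝ =>
      (G + (ε : ℂ) • (1 : Matrix (Fin N) (Fin N) ℂ)).det.re := by fun_prop
  have ht : Filter.Tendsto
      (fun ε : ℝ => (G + (ε : ℂ) • (1 : Matrix (Fin N) (Fin N) ℂ)).det.re)
      (nhdsWithin 0 (Set.Ioi 0)) (nhdsWithin 0 (Set.Ioi 0)) := by
    refine tendsto_nhdsWithin_iff.2 ⟨?_, ?_⟩
    · have := (hcont.tendsto 0).mono_left (nhdsWithin_le_nhds (s := Set.Ioi (0 : ℝ)))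
      simpa [hdet] using this
    · filter_upwards [self_mem_nhdsWithin] with ε hε
      exact re_det_pos (hpd ε hε)
  have ht2 := ENNReal.tendsto_ofReal_atTop.comp
    ((ht.inv_tendsto_nhdsGT_zero).const_mul_atTop (pow_pos Real.pi_pos N))
  refine top_le_iff.1 (le_of_tendsto ht2 ?_)
  filter_upwards [self_mem_nhdsWithin] with ε hε
  exact hle ε hε

/-- The summand x†x / Es of the metric cancels the exponent of the prior, leaving only its
normalizing constant. -/
theorem mismatchedOutput_eq {Es : ℝ} (hEs : 0 < Es) (F : Matrix (Fin M) (Fin N) ℂ)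
    (G : Matrix (Fin N) (Fin N) ℂ) (y : Fin M → ℂ) :
    mismatchedOutput Es F G y = ENNReal.ofReal (1 / (Real.pi * Es) ^ N) *
      ∫⁻ x, ENNReal.ofReal
        (Real.exp (2 * (star y ⬝ᵥ (F *ᵥ x)).re - (star x ⬝ᵥ (G *ᵥ x)).re)) := by
  have hpi := Real.pi_pos
  rw [mismatchedOutput, complexGaussian,
    lintegral_withDensity_eq_lintegral_mul_non_measurable _ (by fun_prop) (by simp),
    ← lintegral_const_mul _ (by fun_prop)]
  refine lintegral_congr fun x => ?_
  rw [Pi.mul_apply, mismatchedCond, ← ENNReal.ofReal_mul (by positivity),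
    ← ENNReal.ofReal_mul (by positivity), mul_assoc, ← Real.exp_add, modifiedMetric]
  have : (star x ⬝ᵥ x).re = ∑ i, ‖x i‖ ^ 2 := by
    rw [dotProduct, Complex.re_sum]
    refine Finset.sum_congr rfl fun i _ => ?_
    rw [← Complex.normSq_eq_norm_sq, ← Complex.ofReal_re (Complex.normSq (x i)),
      Complex.normSq_eq_conj_mul_self]; rfl
  rw [this]
  congr 3
  ring

theorem log_mismatchedOutput {Es : ℝ} (hEs : 0 < Es) (F : Matrix (Fin M) (Fin N) ℂ)
    {G : Matrix (Fin N) (Fin N) ℂ} (hG : G.PosDef) (y : Fin M → ℂ) :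
    ENNReal.log (mismatchedOutput Es F G y) =
      (((star y ⬝ᵥ ((F * G⁻¹ * Fᴴ) *ᵥ y)).re - N * Real.log Es - Real.log G.det.re : ℝ) :
        EReal) := by
  have hpi := Real.pi_pos
  have hd := re_det_pos hG
  rw [mismatchedOutput_eq hEs, lintegral_exp_quadratic F hG, ← ENNReal.ofReal_mul (by positivity),
    ENNReal.log_ofReal_of_pos (by positivity), Real.log_mul (by positivity) (by positivity),
    Real.log_mul (by positivity) (by positivity), Real.log_div (by positivity) hd.ne',
    Real.log_exp, one_div, Real.log_inv, mul_pow, Real.log_mul (by positivity) (by positivity),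
    Real.log_pow, Real.log_pow]
  congr 1
  ring

theorem mismatchedOutput_eq_top {Es : ℝ} (hEs : 0 < Es) (F : Matrix (Fin M) (Fin N) ℂ)
    {G : Matrix (Fin N) (Fin N) ℂ} (hG : G.PosSemidef) (hdet : G.det = 0) (y : Fin M → ℂ) :
    mismatchedOutput Es F G y = ⊤ := by
  have hpi := Real.pi_pos
  rw [mismatchedOutput_eq hEs, lintegral_exp_quadratic_eq_top F hG hdet]
  exact ENNReal.mul_top (ENNReal.ofReal_pos.2 (by positivity)).ne'

end gaussianIntegral

/-! ### Expectations under the true channel law. -/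

theorem extendedExpectation_coe {Ω : Type*} [MeasurableSpace Ω] {P : Measure Ω} {f : Ω → ℝ}
    (hf : Integrable f P) :
    extendedExpectation P (fun ω => (f ω : EReal)) = ((∫ ω, f ω ∂P : ℝ) : EReal) := by
  have hfin : ∀ {g : Ω → ℝ}, Integrable g P → ∫⁻ ω, ENNReal.ofReal (g ω) ∂P ≠ ⊤ := fun hg =>
    hg.lintegral_lt_top.ne
  simp only [extendedExpectation, ← EReal.coe_neg, EReal.real_coe_toENNReal]
  rw [integral_eq_lintegral_pos_part_sub_lintegral_neg_part hf, EReal.coe_sub,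
    EReal.coe_ennreal_toReal (hfin hf), EReal.coe_ennreal_toReal (hfin (g := fun ω => -f ω) hf.neg)]

section channel

variable {M N : ℕ}

theorem dotProduct_mulVec_eq_sum {m n : Type*} [Fintype m] [Fintype n] (B : Matrix m n ℂ)
    (u : m → ℂ) (x : n → ℂ) :
    star u ⬝ᵥ (B *ᵥ x) = ∑ i, ∑ j, B i j * (star (u i) * x j) := by
  simp only [dotProduct, mulVec, Finset.mul_sum, Pi.star_apply]
  exact Finset.sum_congr rfl fun i _ => Finset.sum_congr rfl fun j _ => by ring

theorem integrable_quadraticForm {v : ℝ} (hv : 0 < v) (A : Matrix (Fin N) (Fin N) ℂ) :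
    Integrable (fun x => star x ⬝ᵥ (A *ᵥ x)) (complexGaussian N v) := by
  simp_rw [dotProduct_mulVec_eq_sum]
  exact integrable_finsetSum _ fun i _ => integrable_finsetSum _ fun j _ =>
    (integrable_star_mul_coord hv i j).const_mul _

theorem integral_quadraticForm {v : ℝ} (hv : 0 < v) (A : Matrix (Fin N) (Fin N) ℂ) :
    ∫ x, star x ⬝ᵥ (A *ᵥ x) ∂(complexGaussian N v) = v * A.trace := by
  simp_rw [dotProduct_mulVec_eq_sum]
  refine (integral_finsetSum _ fun i _ => integrable_finsetSum _ fun j _ =>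
    (integrable_star_mul_coord hv i j).const_mul _).trans ?_
  rw [Matrix.trace, Finset.mul_sum]
  refine Finset.sum_congr rfl fun i _ =>
    (integral_finsetSum _ fun j _ => (integrable_star_mul_coord hv i j).const_mul _).trans ?_
  simp_rw [integral_const_mul, integral_star_mul_coord hv]
  simp [mul_comm]

variable {Es N0 : ℝ}

theorem integrable_star_mul_prod (hEs : 0 < Es) (hN0 : 0 < N0) (i : Fin M) (j : Fin N) :
    Integrable (fun p : (Fin N → ℂ) × (Fin M → ℂ) => star (p.2 i) * p.1 j)
      ((complexGaussian N Es).prod (complexGaussian M N0)) := by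
  have := isProbabilityMeasure_complexGaussian (n := N) hEs
  have := isProbabilityMeasure_complexGaussian (n := M) hN0
  have h : Integrable (fun x => star (x i)) (complexGaussian M N0) := by
    simpa using (Complex.conjCLE.toContinuousLinearMap.integrable_comp (integrable_coord hN0 i))
  exact ((integrable_coord hEs j).mul_prod h).congr (.of_forall fun p => mul_comm _ _)

theorem integral_star_mul_prod (hEs : 0 < Es) (hN0 : 0 < N0) (i : Fin M) (j : Fin N) :
    ∫ p, star (p.2 i) * p.1 j ∂((complexGaussian N Es).prod (complexGaussian M N0)) = 0 := by
  have := isProbabilityMeasure_complexGaussian (n := N) hEs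
  have := isProbabilityMeasure_complexGaussian (n := M) hN0
  have h := integral_prod_mul (μ := complexGaussian N Es) (ν := complexGaussian M N0)
    (fun x => x j) (fun w => star (w i))
  rw [integral_coord hEs, zero_mul] at h
  rw [← h]
  exact integral_congr_ae (.of_forall fun p => mul_comm _ _)

theorem integrable_crossForm (hEs : 0 < Es) (hN0 : 0 < N0) (B : Matrix (Fin M) (Fin N) ℂ) :
    Integrable (fun p : (Fin N → ℂ) × (Fin M → ℂ) => star p.2 ⬝ᵥ (B *ᵥ p.1))
      ((complexGaussian N Es).prod (complexGaussian M N0)) := by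
  simp_rw [dotProduct_mulVec_eq_sum]
  exact integrable_finsetSum _ fun i _ => integrable_finsetSum _ fun j _ =>
    (integrable_star_mul_prod hEs hN0 i j).const_mul _

theorem integral_crossForm (hEs : 0 < Es) (hN0 : 0 < N0) (B : Matrix (Fin M) (Fin N) ℂ) :
    ∫ p, star p.2 ⬝ᵥ (B *ᵥ p.1) ∂((complexGaussian N Es).prod (complexGaussian M N0)) = 0 := by
  simp_rw [dotProduct_mulVec_eq_sum]
  refine (integral_finsetSum _ fun i _ => integrable_finsetSum _ fun j _ =>
    (integrable_star_mul_prod hEs hN0 i j).const_mul _).trans ?_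
  refine Finset.sum_eq_zero fun i _ =>
    (integral_finsetSum _ fun j _ => (integrable_star_mul_prod hEs hN0 i j).const_mul _).trans ?_
  simp_rw [integral_const_mul, integral_star_mul_prod hEs hN0]
  simp

/-- In the independent variables x and w the cross form has mean zero, so `B` leaves no trace in the
value; the covariances Es I and N0 I turn the other two forms into traces. -/
theorem extendedExpectation_channelLaw (hEs : 0 < Es) (hN0 : 0 < N0)
    (H : Matrix (Fin M) (Fin N) ℂ) {f : (Fin N → ℂ) × (Fin M → ℂ) → ℝ} (hf : Continuous f)
    (A : Matrix (Fin N) (Fin N) ℂ) (B : Matrix (Fin M) (Fin N) ℂ) (D : Matrix (Fin M) (Fin M) ℂ)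
    (c : ℝ)
    (h : ∀ x w, f (x, H *ᵥ x + w) =
      (star x ⬝ᵥ (A *ᵥ x) + star w ⬝ᵥ (B *ᵥ x) + star w ⬝ᵥ (D *ᵥ w)).re + c) :
    extendedExpectation (channelLaw H Es N0) (fun p => (f p : EReal)) =
      (((Es * A.trace + N0 * D.trace).re + c : ℝ) : EReal) := by
  have := isProbabilityMeasure_complexGaussian (n := N) hEs
  have := isProbabilityMeasure_complexGaussian (n := M) hN0
  have hA := (integrable_quadraticForm hEs A).comp_fst (complexGaussian M N0)
  have hD := (integrable_quadraticForm hN0 D).comp_snd (complexGaussian N Es)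
  have hB := integrable_crossForm hEs hN0 B
  have hsum := (hA.add hB).add hD
  have hre := Complex.reCLM.integrable_comp hsum
  have hm : Measurable fun p : (Fin N → ℂ) × (Fin M → ℂ) => (p.1, H *ᵥ p.1 + p.2) := by
    fun_prop
  have hcomp : (f ∘ fun p : (Fin N → ℂ) × (Fin M → ℂ) => (p.1, H *ᵥ p.1 + p.2)) =
      fun p => Complex.reCLM (((fun p : (Fin N → ℂ) × (Fin M → ℂ) => star p.1 ⬝ᵥ (A *ᵥ p.1)) +
        (fun p : (Fin N → ℂ) × (Fin M → ℂ) => star p.2 ⬝ᵥ (B *ᵥ p.1)) +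
        fun p : (Fin N → ℂ) × (Fin M → ℂ) => star p.2 ⬝ᵥ (D *ᵥ p.2)) p) + c := by
    funext p
    exact h p.1 p.2
  have hint : Integrable f (channelLaw H Es N0) := by
    rw [channelLaw, integrable_map_measure hf.aestronglyMeasurable hm.aemeasurable, hcomp]
    exact hre.add (integrable_const c)
  rw [extendedExpectation_coe hint, channelLaw,
    integral_map hm.aemeasurable hf.aestronglyMeasurable]
  have h2 : ∫ p, f (p.1, H *ᵥ p.1 + p.2)
      ∂((complexGaussian N Es).prod (complexGaussian M N0)) =
      (Es * A.trace + N0 * D.trace).re + c := by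
    have h3 : ∀ p : (Fin N → ℂ) × (Fin M → ℂ), f (p.1, H *ᵥ p.1 + p.2) = _ := congrFun hcomp
    simp_rw [h3]
    rw [integral_add hre (integrable_const c), Complex.reCLM.integral_comp_comm hsum,
      integral_add' (hA.add hB) hD, integral_add' hA hB, integral_crossForm hEs hN0,
      integral_fun_fst (fun x : Fin N → ℂ => star x ⬝ᵥ (A *ᵥ x)),
      integral_fun_snd (fun w : Fin M → ℂ => star w ⬝ᵥ (D *ᵥ w)),
      integral_quadraticForm hEs, integral_quadraticForm hN0]
    simp
  rw [h2]

theorem isProbabilityMeasure_channelLaw (hEs : 0 < Es) (hN0 : 0 < N0)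
    (H : Matrix (Fin M) (Fin N) ℂ) : IsProbabilityMeasure (channelLaw H Es N0) := by
  have := isProbabilityMeasure_complexGaussian (n := N) hEs
  have := isProbabilityMeasure_complexGaussian (n := M) hN0
  exact Measure.isProbabilityMeasure_map (by fun_prop)

theorem expectation_log_mismatchedCond (hEs : 0 < Es) (hN0 : 0 < N0)
    (H F : Matrix (Fin M) (Fin N) ℂ) (G : Matrix (Fin N) (Fin N) ℂ) :
    extendedExpectation (channelLaw H Es N0)
      (fun p => ENNReal.log (mismatchedCond Es F G p.2 p.1)) =
      ((2 * Es * (Hᴴ * F).trace.re - Es * G.trace.re + N : ℝ) : EReal) := by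
  have h1 : ∀ p : (Fin N → ℂ) × (Fin M → ℂ), ENNReal.log (mismatchedCond Es F G p.2 p.1) =
      (modifiedMetric Es F G p.2 p.1 : EReal) := fun p => by
    rw [mismatchedCond, ENNReal.log_ofReal_of_pos (Real.exp_pos _), Real.log_exp]
  simp_rw [h1]
  rw [extendedExpectation_channelLaw hEs hN0 H
    (f := fun p => modifiedMetric Es F G p.2 p.1) (by unfold modifiedMetric; fun_prop)
    ((2 : ℂ) • (Hᴴ * F) - G + ((1 / Es : ℝ) : ℂ) • 1) ((2 : ℂ) • F) 0 0]
  · congr 1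
    simp only [trace_add, trace_sub, trace_smul, trace_one, trace_zero, Fintype.card_fin,
      smul_eq_mul, mul_zero, add_zero, Complex.re_ofReal_mul, Complex.add_re, Complex.sub_re]
    have : ((2 : ℂ) * (Hᴴ * F).trace).re = 2 * (Hᴴ * F).trace.re := by simp
    rw [this, Complex.natCast_re]
    field_simp
  · intro x w
    have : star (H *ᵥ x + w) ⬝ᵥ (F *ᵥ x) = star x ⬝ᵥ ((Hᴴ * F) *ᵥ x) + star w ⬝ᵥ (F *ᵥ x) := by
      rw [star_add, add_dotProduct, star_mulVec, ← dotProduct_mulVec, mulVec_mulVec]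
    simp only [modifiedMetric, this, add_mulVec, sub_mulVec, smul_mulVec, one_mulVec,
      dotProduct_add, dotProduct_sub, dotProduct_smul, smul_eq_mul, zero_mulVec, dotProduct_zero,
      add_zero, Complex.add_re, Complex.sub_re, Complex.re_ofReal_mul]
    have h2 : ∀ z : ℂ, (2 * z).re = 2 * z.re := by simp
    rw [h2, h2]
    ring

theorem expectation_log_mismatchedOutput (hEs : 0 < Es) (hN0 : 0 < N0)
    (H F : Matrix (Fin M) (Fin N) ℂ) {G : Matrix (Fin N) (Fin N) ℂ} (hG : G.PosDef) :
    extendedExpectation (channelLaw H Es N0)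
      (fun p => ENNReal.log (mismatchedOutput Es F G p.2)) =
      (((Es * (Hᴴ * (F * G⁻¹ * Fᴴ) * H).trace + N0 * (F * G⁻¹ * Fᴴ).trace).re +
        (-(N * Real.log Es) - Real.log G.det.re) : ℝ) : EReal) := by
  simp_rw [log_mismatchedOutput hEs F hG]
  obtain ⟨K, hK⟩ : ∃ K, K = F * G⁻¹ * Fᴴ := ⟨_, rfl⟩
  rw [← hK]
  refine extendedExpectation_channelLaw hEs hN0 H
    (f := fun p => (star p.2 ⬝ᵥ (K *ᵥ p.2)).re - N * Real.log Es - Real.log G.det.re)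
    (by fun_prop) (Hᴴ * K * H) (K * H + Kᴴ * H) K _ fun x w => ?_
  have h1 : star (H *ᵥ x + w) ⬝ᵥ (K *ᵥ (H *ᵥ x + w)) =
      star x ⬝ᵥ ((Hᴴ * K * H) *ᵥ x) + star x ⬝ᵥ ((Hᴴ * K) *ᵥ w) + star w ⬝ᵥ ((K * H) *ᵥ x) +
        star w ⬝ᵥ (K *ᵥ w) := by
    simp only [star_add, add_dotProduct, mulVec_add, dotProduct_add, star_mulVec, add_vecMul,
      dotProduct_mulVec, ← mulVec_mulVec, vecMul_vecMul, Matrix.mul_assoc]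
    ring
  -- A number and its conjugate have equal real parts, so both cross terms merge into one form
  -- w†(·)x without K being Hermitian.
  have h2 : (star x ⬝ᵥ ((Hᴴ * K) *ᵥ w)).re = (star w ⬝ᵥ ((Kᴴ * H) *ᵥ x)).re := by
    rw [← Complex.conj_re, ← Complex.star_def, ← star_dotProduct_star, star_star, star_mulVec,
      dotProduct_comm, conjTranspose_mul, conjTranspose_conjTranspose, dotProduct_mulVec,
      dotProduct_comm]
  simp only [h1, Complex.add_re, h2, add_mulVec, dotProduct_add]
  ring

theorem rateLowerBound_of_posDef (hEs : 0 < Es) (hN0 : 0 < N0)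
    (H F : Matrix (Fin M) (Fin N) ℂ) {G : Matrix (Fin N) (Fin N) ℂ} (hG : G.PosDef) :
    rateLowerBound H Es N0 F G =
      ((2 * Es * (Hᴴ * F).trace.re - Es * G.trace.re + N -
        ((Es * (Hᴴ * (F * G⁻¹ * Fᴴ) * H).trace + N0 * (F * G⁻¹ * Fᴴ).trace).re +
          (-(N * Real.log Es) - Real.log G.det.re)) : ℝ) : EReal) := by
  rw [rateLowerBound, expectation_log_mismatchedCond hEs hN0,
    expectation_log_mismatchedOutput hEs hN0 H F hG, ← EReal.coe_sub]

/-- The first expectation is finite while the second is `⊤`, the log-output being identically `⊤`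
under a probability measure. -/
theorem rateLowerBound_of_det_eq_zero (hEs : 0 < Es) (hN0 : 0 < N0)
    (H F : Matrix (Fin M) (Fin N) ℂ) {G : Matrix (Fin N) (Fin N) ℂ} (hG : G.PosSemidef)
    (hdet : G.det = 0) : rateLowerBound H Es N0 F G = ⊥ := by
  have := isProbabilityMeasure_channelLaw hEs hN0 H
  have h : extendedExpectation (channelLaw H Es N0)
      (fun p => ENNReal.log (mismatchedOutput Es F G p.2)) = ⊤ := by
    simp [mismatchedOutput_eq_top hEs F hG hdet, extendedExpectation]
  rw [rateLowerBound, expectation_log_mismatchedCond hEs hN0, h]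
  simp

end channel

/-! ### The MMSE filter and the optimization over `F`. -/

section filter

variable {M N : ℕ} {Es N0 : ℝ}

theorem posDef_gram_add (hEs : 0 < Es) (hN0 : 0 < N0) (H : Matrix (Fin M) (Fin N) ℂ) :
    (H * Hᴴ + ((N0 / Es : ℝ) : ℂ) • (1 : Matrix (Fin M) (Fin M) ℂ)).PosDef :=
  PosDef.posSemidef_add (posSemidef_self_mul_conjTranspose H)
    (PosDef.one.smul (by exact_mod_cast div_pos hN0 hEs))

/-- Orthonormality removes `Q` from the Gram matrix, which is what identifies L†L with the inverse
error covariance. -/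
theorem gram_of_isThinQL (hEs : 0 < Es) (hN0 : 0 < N0) {H : Matrix (Fin M) (Fin N) ℂ}
    {Q : Matrix (Fin M ⊕ Fin N) (Fin N) ℂ} {L : Matrix (Fin N) (Fin N) ℂ}
    (h : IsThinQL (augmentedChannel H Es N0) Q L) :
    Lᴴ * L = ((1 / N0 : ℝ) : ℂ) • (Hᴴ * H) + ((1 / Es : ℝ) : ℂ) • 1 := by
  have h1 : Lᴴ * L = (augmentedChannel H Es N0)ᴴ * augmentedChannel H Es N0 := by
    rw [h.eq_mul, conjTranspose_mul, Matrix.mul_assoc, ← Matrix.mul_assoc Qᴴ, h.orthonormal,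
      Matrix.one_mul]
  have h2 : ∀ r : ℝ, 0 < r → ((1 / √r : ℝ) : ℂ) * ((1 / √r : ℝ) : ℂ) = ((1 / r : ℝ) : ℂ) :=
    fun r hr => by
      rw [← Complex.ofReal_mul, div_mul_div_comm, one_mul, Real.mul_self_sqrt hr.le]
  rw [h1, augmentedChannel, conjTranspose_fromRows_eq_fromCols_conjTranspose,
    fromCols_mul_fromRows]
  simp only [conjTranspose_smul, smul_mul, Matrix.mul_smul, smul_smul, Complex.star_def,
    Complex.conj_ofReal, h2 _ hEs, h2 _ hN0, conjTranspose_one, Matrix.mul_one]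

/-- The MMSE error covariance. -/
theorem inv_gram_eq (hEs : 0 < Es) (hN0 : 0 < N0) (H : Matrix (Fin M) (Fin N) ℂ) :
    (((1 / N0 : ℝ) : ℂ) • (Hᴴ * H) + ((1 / Es : ℝ) : ℂ) • (1 : Matrix (Fin N) (Fin N) ℂ))⁻¹ =
      (Es : ℂ) • (1 - mmseFilter H Es N0 * H) := by
  have hA := (isUnit_iff_isUnit_det _).1 (posDef_gram_add hEs hN0 H).isUnit
  set A := H * Hᴴ + ((N0 / Es : ℝ) : ℂ) • (1 : Matrix (Fin M) (Fin M) ℂ) with hAdef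
  have hEs' : (Es : ℂ) ≠ 0 := by exact_mod_cast hEs.ne'
  have hN0' : (N0 : ℂ) ≠ 0 := by exact_mod_cast hN0.ne'
  refine inv_eq_left_inv ?_
  -- Write HH† = A - (N0/Es) I and cancel A against the inverse in the filter.
  have h1 : mmseFilter H Es N0 * H * (Hᴴ * H) =
      Hᴴ * H - ((N0 / Es : ℝ) : ℂ) • (mmseFilter H Es N0 * H) := by
    have h2 : H * (Hᴴ * H) = A * H - ((N0 / Es : ℝ) : ℂ) • H := by
      rw [hAdef, Matrix.add_mul, smul_mul, Matrix.one_mul, Matrix.mul_assoc, add_sub_cancel_right]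
    rw [Matrix.mul_assoc, h2, Matrix.mul_sub, Matrix.mul_smul, mmseFilter, ← hAdef,
      ← Matrix.mul_assoc, Matrix.mul_assoc Hᴴ, nonsing_inv_mul _ hA, Matrix.mul_one]
  rw [smul_mul, Matrix.mul_add, Matrix.mul_smul, Matrix.mul_smul, Matrix.mul_one, Matrix.sub_mul,
    Matrix.one_mul, h1]
  push_cast
  ext i j
  simp only [Matrix.smul_apply, Matrix.add_apply, Matrix.sub_apply, smul_eq_mul]
  field_simp
  ring

/-- Completing the square in `F` with weights G⁻¹ and A: the relation WA = H† makes W†G the centre,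
and the terms free of `F` combine to -Es tr(G(1 - WH)), the error covariance term. -/
theorem rate_trace_identity (hEs : 0 < Es) (hN0 : 0 < N0) (H F : Matrix (Fin M) (Fin N) ℂ)
    {G : Matrix (Fin N) (Fin N) ℂ} (hG : G.PosDef) :
    (Es : ℂ) * ((Hᴴ * F).trace + (Fᴴ * H).trace) - Es * G.trace -
        (Es * (Hᴴ * (F * G⁻¹ * Fᴴ) * H).trace + N0 * (F * G⁻¹ * Fᴴ).trace) =
      -(G * (((1 / N0 : ℝ) : ℂ) • (Hᴴ * H) + ((1 / Es : ℝ) : ℂ) • 1)⁻¹).trace -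
        Es * ((F - (mmseFilter H Es N0)ᴴ * G) * G⁻¹ * (F - (mmseFilter H Es N0)ᴴ * G)ᴴ *
          (H * Hᴴ + ((N0 / Es : ℝ) : ℂ) • 1)).trace := by
  have hEs' : (Es : ℂ) ≠ 0 := by exact_mod_cast hEs.ne'
  have hApd := posDef_gram_add hEs hN0 H
  have hA := (isUnit_iff_isUnit_det _).1 hApd.isUnit
  have hGu := (isUnit_iff_isUnit_det _).1 hG.isUnit
  rw [inv_gram_eq hEs hN0]
  set W := mmseFilter H Es N0 with hW
  obtain ⟨K, hK⟩ : ∃ K, K = F * G⁻¹ * Fᴴ := ⟨_, rfl⟩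
  set A := H * Hᴴ + ((N0 / Es : ℝ) : ℂ) • (1 : Matrix (Fin M) (Fin M) ℂ) with hAdef
  have hWA : W * A = Hᴴ := by
    rw [hW, mmseFilter, ← hAdef, Matrix.mul_assoc, nonsing_inv_mul _ hA, Matrix.mul_one]
  have hAW : A * Wᴴ = H := by
    have := congrArg conjTranspose hWA
    rwa [conjTranspose_mul, hApd.isHermitian.eq, conjTranspose_conjTranspose] at this
  have hHW : Hᴴ * Wᴴ = W * H := by
    rw [← hWA, Matrix.mul_assoc, hAW]
  have hFGW : F * G⁻¹ * (G * W) = F * W := by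
    rw [Matrix.mul_assoc, ← Matrix.mul_assoc G⁻¹, nonsing_inv_mul _ hGu, Matrix.one_mul]
  have hexp : (F - Wᴴ * G) * G⁻¹ * (F - Wᴴ * G)ᴴ * A =
      K * A - F * Hᴴ - Wᴴ * (Fᴴ * A) + Wᴴ * (G * Hᴴ) := by
    rw [conjTranspose_sub, conjTranspose_mul, conjTranspose_conjTranspose, hG.isHermitian.eq,
      Matrix.sub_mul, Matrix.mul_assoc Wᴴ, mul_nonsing_inv _ hGu, Matrix.mul_one, Matrix.mul_sub,
      Matrix.sub_mul, Matrix.sub_mul, ← hK,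
      Matrix.sub_mul (F * G⁻¹), hFGW]
    simp only [Matrix.sub_mul, Matrix.mul_assoc, hWA]
    abel
  -- Es A is the covariance of y, so both sides are the mean of y†Ky.
  have hKA : (Es : ℂ) * (K * A).trace = Es * (Hᴴ * K * H).trace + N0 * K.trace := by
    rw [hAdef, Matrix.mul_add, trace_add, Matrix.mul_smul, Matrix.mul_one, trace_smul,
      ← Matrix.mul_assoc, trace_mul_comm (K * H), ← Matrix.mul_assoc, smul_eq_mul]
    push_cast
    field_simp
  have h1 : (Wᴴ * (Fᴴ * A)).trace = (Fᴴ * H).trace := by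
    rw [trace_mul_comm, Matrix.mul_assoc, hAW]
  have h2 : (Wᴴ * (G * Hᴴ)).trace = (G * (W * H)).trace := by
    rw [trace_mul_comm, Matrix.mul_assoc, hHW]
  rw [hexp, ← hK, ← hKA]
  simp only [trace_add, trace_sub, h1, h2, trace_mul_comm F, Matrix.mul_smul, trace_smul,
    Matrix.mul_sub, Matrix.mul_one, smul_eq_mul]
  ring

/-- With A = C†C and B = E†E the trace is ‖C D E†‖², and C and E are invertible. -/
theorem trace_sandwich_nonneg {A : Matrix (Fin M) (Fin M) ℂ} (hA : A.PosDef)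
    {B : Matrix (Fin N) (Fin N) ℂ} (hB : B.PosDef) (D : Matrix (Fin M) (Fin N) ℂ) :
    0 ≤ (D * B * Dᴴ * A).trace.re ∧ ((D * B * Dᴴ * A).trace.re = 0 → D = 0) := by
  obtain ⟨C, hC⟩ := exists_eq_conjTranspose_mul_self hA.posSemidef
  obtain ⟨E, hE⟩ := exists_eq_conjTranspose_mul_self hB.posSemidef
  have h1 : (D * B * Dᴴ * A).trace = ((C * D * Eᴴ) * (C * D * Eᴴ)ᴴ).trace := by
    rw [hC, hE, ← Matrix.mul_assoc (D * (Eᴴ * E) * Dᴴ), trace_mul_comm]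
    simp only [conjTranspose_mul, conjTranspose_conjTranspose, Matrix.mul_assoc]
  have hCu : IsUnit C.det := by
    have := (isUnit_iff_isUnit_det _).1 hA.isUnit
    rw [hC, det_mul] at this
    exact isUnit_of_mul_isUnit_right this
  have hEu : IsUnit (Eᴴ).det := by
    have := (isUnit_iff_isUnit_det _).1 hB.isUnit
    rw [hE, det_mul] at this
    exact isUnit_of_mul_isUnit_left this
  have h2 := trace_mul_conjTranspose_eq_sum_normSq (C * D * Eᴴ)
  refine ⟨?_, fun h => ?_⟩
  · rw [h1, h2, Complex.ofReal_re]
    exact Finset.sum_nonneg fun _ _ => Finset.sum_nonneg fun _ _ => Complex.normSq_nonneg _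
  · rw [h1, h2, Complex.ofReal_re] at h
    rw [h, Complex.ofReal_zero, trace_mul_conjTranspose_self_eq_zero_iff] at h2
    calc D = C⁻¹ * (C * D * Eᴴ) * (Eᴴ)⁻¹ := by
            rw [Matrix.mul_assoc C, ← Matrix.mul_assoc C⁻¹, nonsing_inv_mul _ hCu, Matrix.one_mul,
              Matrix.mul_assoc, mul_nonsing_inv _ hEu, Matrix.mul_one]
      _ = 0 := by rw [h2, Matrix.mul_zero, Matrix.zero_mul]

/-- The two optimizations decouple here: `F` occurs only in the last trace. -/
theorem rateLowerBound_eq (hEs : 0 < Es) (hN0 : 0 < N0) (H F : Matrix (Fin M) (Fin N) ℂ)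
    {G : Matrix (Fin N) (Fin N) ℂ} (hG : G.PosDef)
    {Q : Matrix (Fin M ⊕ Fin N) (Fin N) ℂ} {L : Matrix (Fin N) (Fin N) ℂ}
    (h : IsThinQL (augmentedChannel H Es N0) Q L) :
    rateLowerBound H Es N0 F G =
      ((N + N * Real.log Es + (Real.log G.det.re - (G * (Lᴴ * L)⁻¹).trace.re) -
        Es * ((F - (mmseFilter H Es N0)ᴴ * G) * G⁻¹ * (F - (mmseFilter H Es N0)ᴴ * G)ᴴ *
          (H * Hᴴ + ((N0 / Es : ℝ) : ℂ) • 1)).trace.re : ℝ) : EReal) := by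
  rw [rateLowerBound_of_posDef hEs hN0 H F hG, gram_of_isThinQL hEs hN0 h]
  have h1 := congrArg Complex.re (rate_trace_identity hEs hN0 H F hG)
  have h2 : (Fᴴ * H).trace.re = (Hᴴ * F).trace.re := by
    rw [← conjTranspose_conjTranspose H, ← conjTranspose_mul, trace_conjTranspose,
      conjTranspose_conjTranspose]
    exact Complex.conj_re _
  simp only [Complex.sub_re, Complex.neg_re, Complex.re_ofReal_mul, Complex.add_re, h2] at h1
  congr 1
  simp only [Complex.add_re, Complex.re_ofReal_mul]
  linarith

end filter

/-! ### The optimal pair and its rate. -/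

theorem theorem3 {M N ν : ℕ} (hν : 1 ≤ ν) (hνN : ν < N)
    (H : Matrix (Fin M) (Fin N) ℂ) (Es N0 : ℝ) (hEs : 0 < Es) (hN0 : 0 < N0)
    (Qa : Matrix (Fin M ⊕ Fin N) (Fin N) ℂ) (La : Matrix (Fin N) (Fin N) ℂ)
    (hQL : IsThinQL (augmentedChannel H Es N0) Qa La)
    (Lap Gopt : Matrix (Fin N) (Fin N) ℂ) (Fopt : Matrix (Fin M) (Fin N) ℂ)
    (hLap : Lap = puncture ν La)
    (hGopt : Gopt = Lapᴴ * Lap)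
    (hFopt : Fopt = (mmseFilter H Es N0)ᴴ * Gopt) :
    -- the claimed optimum is feasible, and its logarithmic determinant is that of a positive number
    IsPunctured ν Lap ∧ IsAdmissible ν Gopt ∧ Gopt.PosDef ∧
    -- it maximizes the rate bound, and it is the only maximizer
    (∀ (F : Matrix (Fin M) (Fin N) ℂ) (G : Matrix (Fin N) (Fin N) ℂ), IsAdmissible ν G →
      rateLowerBound H Es N0 F G ≤ rateLowerBound H Es N0 Fopt Gopt ∧
      (rateLowerBound H Es N0 F G = rateLowerBound H Es N0 Fopt Gopt →
        F = Fopt ∧ G = Gopt)) ∧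
    -- the optimal value
    rateLowerBound H Es N0 Fopt Gopt =
      ((N * Real.log Es + Real.log (Lapᴴ * Lap).det.re : ℝ) : EReal) := by
  have hL : IsLowerPos La := ⟨hQL.lower, hQL.diag_im, hQL.diag_pos⟩
  have hP : IsPunctured ν Lap := hLap ▸ isPunctured_puncture ν hL
  have hLapDet : Lap.det ≠ 0 := by
    rw [hLap]; exact (isLowerPos_puncture ν hL).isUnit_det.ne_zero
  have hpsd : Gopt.PosSemidef := hGopt ▸ posSemidef_conjTranspose_mul_self Lap
  have hpd : Gopt.PosDef := by
    rw [hpsd.posDef_iff_det_ne_zero, hGopt, det_mul, det_conjTranspose]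
    exact mul_ne_zero (star_ne_zero.2 hLapDet) hLapDet
  have hval : rateLowerBound H Es N0 Fopt Gopt =
      ((N * Real.log Es + Real.log (Lapᴴ * Lap).det.re : ℝ) : EReal) := by
    -- At the optimum D = 0, and the trace term equals N, cancelling the constant N.
    rw [rateLowerBound_eq hEs hN0 H Fopt hpd hQL, hFopt, sub_self, hGopt]
    simp only [Matrix.zero_mul, trace_zero, Complex.zero_re, mul_zero, sub_zero]
    rw [hLap, trace_gram_puncture_mul_inv ν hL]
    congr 1
    ring
  refine ⟨hP, ⟨hpsd, Lap, hP, hGopt⟩, hpd, fun F G hG => ?_, hval⟩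
  obtain ⟨hGpsd, J, hJ, hGJ⟩ := hG
  by_cases hdet : G.det = 0
  · rw [rateLowerBound_of_det_eq_zero hEs hN0 H F hGpsd hdet, hval]
    exact ⟨bot_le, fun h => absurd h.symm (EReal.coe_ne_bot _)⟩
  have hGpd : G.PosDef := hGpsd.posDef_iff_det_ne_zero.2 hdet
  have hJdet : J.det ≠ 0 := fun h => hdet (by rw [hGJ, det_mul, h, mul_zero])
  obtain ⟨h1, h2⟩ := log_det_sub_trace_le ν hL hJ hJdet
  obtain ⟨h3, h4⟩ := trace_sandwich_nonneg (posDef_gram_add hEs hN0 H) hGpd.inv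
    (F - (mmseFilter H Es N0)ᴴ * G)
  rw [hval, rateLowerBound_eq hEs hN0 H F hGpd hQL, EReal.coe_le_coe_iff, EReal.coe_eq_coe_iff]
  rw [← hGJ, ← hLap] at h1 h2
  have h5 := mul_nonneg hEs.le h3
  -- The gap is a sum of two nonnegative parts. Equality first fixes `G`, then makes the sandwich
  -- trace vanish, which fixes `F`.
  refine ⟨by linarith, fun heq => ?_⟩
  have hGG : G = Gopt := by rw [hGopt]; exact h2 (by linarith)
  have h6 : F - (mmseFilter H Es N0)ᴴ * G = 0 :=
    h4 ((mul_eq_zero.1 (by linarith)).resolve_left hEs.ne')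
  exact ⟨by rw [hFopt, ← hGG]; exact sub_eq_zero.1 h6, hGG⟩
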